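/- For $t\in\mathbb{R}$ let $(t)_0=1$, $(t)_{n+1}=(t+n)\,(t)_n$, and let $$ {}_2F_1(p,q;r;x)=\sum_{n\ge 0}\frac{(p)_n(q)_n}{n!\,(r)_n}x^n,\qquad {}_3F_2(A,B,C;D,E;x)=\sum_{n\ge 0}\frac{(A)_n(B)_n(C)_n}{n!\,(D)_n(E)_n}x^n .$$ Let $P$ be the set of all $v=(a,b,p,q,r)^T\in\mathbb{R}^5$ such that $r\notin\{0,-1,-2,\dots\}$, ${}_2F_1(p,q;r;x)>0$ for all $x\in(0,1)$, and $a>0$, $b>0$, $r+b-p-q>0$. For $v\in P$ the beta-hypergeometric distribution is $$BH(v)(dx)=\frac{x^{a-1}(1-x)^{b-1}\,{}_2F_1(p,q;r;x)}{B(a,b)\,{}_3F_2(a,p,q;r,a+b;1)}\mathbf 1_{(0,1)}(x)\,dx ,$$ and for $c,d>0$ the beta distribution of the second kind is $$\beta^{(2)}_{c,d}(dw)=\frac{1}{B(c,d)}\frac{w^{c-1}}{(1+w)^{c+d}}\mathbf 1_{(0,\infty)}(w)\,dw ,$$ where $B(c,d)=\Gamma(c)\Gamma(d)/\Gamma(c+d)$.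 **Theorem 3.2 (Basic identity).** Let $v=(a,b,p,q,r)^T\in P$ with $a+b-p>0$ and $r-a>0$, and let $$M=\begin{pmatrix}-1&0&0&0&1\\1&1&-1&0&0\\0&1&-1&-1&1\\0&1&0&0&0\\0&1&0&-1&1\end{pmatrix},\qquad \Pi=\begin{pmatrix}1&1&-1&0&0\\-1&0&0&0&1\end{pmatrix}.$$ Then $Mv\in P$. Moreover, if $X\sim BH(v)$ and $W\sim\beta^{(2)}_{\Pi v}$ are independent random variables, where $\beta^{(2)}_{\Pi v}=\beta^{(2)}_{a+b-p,\;r-a}$, then $\frac{1}{1+XW}\sim BH(Mv)$. -/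

import Mathlib

open MeasureTheory ProbabilityTheory Set Matrix

noncomputable section

/-- The generalized hypergeometric series
`₃F₂(A, B, C; D, E; x) = ∑ (A)ₙ (B)ₙ (C)ₙ / (n! (D)ₙ (E)ₙ) xⁿ`. -/
def genHyp32 (A B C D E x : ℝ) : ℝ :=
  ∑' n : ℕ, ((ascPochhammer ℝ n).eval A * (ascPochhammer ℝ n).eval B * (ascPochhammer ℝ n).eval C) /
    ((n.factorial : ℝ) * (ascPochhammer ℝ n).eval D * (ascPochhammer ℝ n).eval E) * x ^ n

/-- The triples `(p, q, r)` such that `r` is not in `{0, -1, -2, …}` and the Gauss hypergeometric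
function `₂F₁(p, q; r; ·)` is positive on `(0, 1)`. -/
def hypPos : Set (ℝ × ℝ × ℝ) :=
  {t | (∀ n : ℕ, t.2.2 ≠ -(n : ℝ)) ∧
    ∀ x ∈ Ioo (0 : ℝ) 1, 0 < ordinaryHypergeometric t.1 t.2.1 t.2.2 x}

/-- The parameter set `P` of the vectors `v = (a, b, p, q, r)` for which the beta-hypergeometric
distribution is defined: `(p, q, r) ∈ hypPos`, and `a`, `b`, `r + b - p - q` are positive. -/
def paramP : Set (Fin 5 → ℝ) :=
  {v | (v 2, v 3, v 4) ∈ hypPos ∧ 0 < v 0 ∧ 0 < v 1 ∧ 0 < v 4 + v 1 - v 2 - v 3}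

/-- The density of the beta-hypergeometric distribution with parameters `v = (a, b, p, q, r)`
at a point `x` of `(0, 1)`:
`x ^ (a - 1) (1 - x) ^ (b - 1) ₂F₁(p, q; r; x) / (B(a, b) ₃F₂(a, p, q; r, a + b; 1))`. -/
def bhDensity (v : Fin 5 → ℝ) (x : ℝ) : ℝ :=
  x ^ (v 0 - 1) * (1 - x) ^ (v 1 - 1) * ordinaryHypergeometric (v 2) (v 3) (v 4) x /
    (beta (v 0) (v 1) * genHyp32 (v 0) (v 2) (v 3) (v 4) (v 0 + v 1) 1)

/-- The beta-hypergeometric distribution `BH(v)` on `(0, 1)`, meaningful for `v ∈ paramP`. -/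
def BH (v : Fin 5 → ℝ) : Measure ℝ :=
  (volume.restrict (Ioo 0 1)).withDensity fun x => ENNReal.ofReal (bhDensity v x)

/-- The beta distribution of the second kind with parameters `c, d > 0`, given as a pair `![c, d]`:
its density on `(0, ∞)` is `w ^ (c - 1) / (B(c, d) (1 + w) ^ (c + d))`. -/
def betaSecondKind (u : Fin 2 → ℝ) : Measure ℝ :=
  (volume.restrict (Ioi 0)).withDensity fun w =>
    ENNReal.ofReal (1 / beta (u 0) (u 1) * (w ^ (u 0 - 1) / (1 + w) ^ (u 0 + u 1)))

/-- The matrix `M`. -/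
def matM : Matrix (Fin 5) (Fin 5) ℝ :=
  !![-1, 0,  0,  0, 1;
      1, 1, -1,  0, 0;
      0, 1, -1, -1, 1;
      0, 1,  0,  0, 0;
      0, 1,  0, -1, 1]

/-- The matrix `Π`. -/
def matPi : Matrix (Fin 2) (Fin 5) ℝ :=
  !![ 1, 1, -1, 0, 0;
     -1, 0,  0, 0, 1]

end

/-!
Write `y = 1 / (1 + x w)`. For fixed `x > 0` and `W` of the second beta law with parameters
`(c, d) = (a + b - p, r - a)`, the variable `1 / (1 + x W)` has the density
`x ^ d y ^ (d - 1) (1 - y) ^ (c - 1) / (B(c, d) (1 - y (1 - x)) ^ (c + d))` on `(0, 1)`.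
Mixing over `x ∼ BH(v)` turns the factor `x ^ (a - 1)` into `x ^ (r - 1)`, and `c + d = r + b - p`,
so that everything rests on the integral
`∫₀¹ x ^ (r - 1) (1 - x) ^ (b - 1) ₂F₁(p, q; r; x) (1 - y (1 - x)) ^ (-(r + b - p)) dx`.
Expanding the last factor in powers of `1 - x` leaves the integrals
`∫₀¹ x ^ (r - 1) (1 - x) ^ (b + n - 1) ₂F₁(p, q; r; x) dx = B(r, b + n) ₂F₁(p, q; r + b + n; 1)`.
Gauss's contiguous relation for `₂F₁(p, q; c; 1)` in `c` makes their ratios explicit, and the sum is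
a multiple of `₂F₁(r + b - p - q, b; r + b - q; y)`. The multiple need not be computed, because both
laws are probability measures. The same relation yields `r + b - q > 0`.
-/

open Filter Topology
open scoped ENNReal

section RatioTest

theorem summable_of_le_sub_succ {u w : ℕ → ℝ} (hu : ∀ n, 0 ≤ u n) (hw : ∀ n, 0 ≤ w n)
    (h : ∀ᶠ n in atTop, u n ≤ w n - w (n + 1)) : Summable u := by
  obtain ⟨N, hN⟩ := eventually_atTop.1 h
  rw [← summable_nat_add_iff N]
  refine summable_of_sum_range_le (c := w N) (fun n => hu _) fun k => ?_
  calc ∑ i ∈ Finset.range k, u (i + N)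
      ≤ ∑ i ∈ Finset.range k, (w (i + N) - w (i + 1 + N)) :=
        Finset.sum_le_sum fun i _ => by
          simpa only [add_right_comm i N 1] using hN (i + N) (Nat.le_add_left N i)
    _ = w (0 + N) - w (k + N) := Finset.sum_range_sub' (fun i => w (i + N)) k
    _ ≤ w N := by simpa only [zero_add, tsub_le_iff_right, le_add_iff_nonneg_right] using hw _

theorem eq_zero_of_summable_of_tendsto_nat_mul {T : ℕ → ℝ} {l : ℝ} (hT : Summable T)
    (hl : Tendsto (fun n : ℕ => n * T n) atTop (𝓝 l)) : l = 0 := by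
  by_contra hl0
  refine Real.not_summable_one_div_natCast (summable_of_isBigO_nat hT ?_)
  have hinv := ((hl.inv₀ hl0).isBigO_one ℝ).mul (Asymptotics.isBigO_refl T atTop)
  refine hinv.congr' ?_ (by simp)
  filter_upwards [hl.eventually_ne hl0] with n hn
  have := left_ne_zero_of_mul hn
  have := right_ne_zero_of_mul hn
  field_simp

variable {T ρ : ℕ → ℝ} {l : ℝ} (hT : ∀ n, T (n + 1) = T n * ρ n) (hl : l < 0)
  (hρ : Tendsto (fun n : ℕ => (n + 1) * ρ n - n) atTop (𝓝 l))
include hT hl hρ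

theorem summable_abs_of_tendsto_ratio : Summable fun n => |T n| := by
  have hl2 : -(l / 2) ≠ 0 := by linarith
  rw [← summable_mul_left_iff hl2]
  refine summable_of_le_sub_succ (w := fun n => n * |T n|)
    (fun n => mul_nonneg (by linarith) (abs_nonneg _)) (fun n => by positivity) ?_
  filter_upwards [hρ.eventually_lt_const (show l < l / 2 by linarith),
    hρ.eventually_const_lt (sub_one_lt l),
    tendsto_natCast_atTop_atTop.eventually_ge_atTop (1 - l)] with n hlt hgt hn
  have hρn : 0 ≤ ρ n :=
    (pos_of_mul_pos_right (by linarith : 0 < (n + 1) * ρ n) (by positivity)).le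
  rw [hT, abs_mul, abs_of_nonneg hρn]
  push_cast
  nlinarith [abs_nonneg (T n)]

theorem tendsto_nat_mul_of_tendsto_ratio : Tendsto (fun n : ℕ => n * T n) atTop (𝓝 0) := by
  have hsum := summable_abs_of_tendsto_ratio hT hl hρ
  have hdiff : Summable fun n : ℕ => ((n + 1) * ρ n - n) * T n := by
    refine summable_of_isBigO_nat hsum ?_
    simpa using ((hρ.isBigO_one ℝ).mul (Asymptotics.isBigO_refl T atTop)).norm_right
  have htel (n : ℕ) : ∑ k ∈ Finset.range n, ((k + 1) * ρ k - k) * T k = n * T n := by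
    induction n with
    | zero => simp
    | succ n ih => rw [Finset.sum_range_succ, ih, hT]; push_cast; ring
  obtain ⟨m, hm⟩ := hdiff
  have hlim : Tendsto (fun n : ℕ => n * T n) atTop (𝓝 m) := by
    simpa only [htel] using hm.tendsto_sum_nat
  rwa [eq_zero_of_summable_of_tendsto_nat_mul hsum.of_abs hlim] at hlim

end RatioTest

section HypergeometricCoefficients

theorem ne_neg_natCast_of_pos {t : ℝ} (ht : 0 < t) (n : ℕ) : t ≠ -n := by
  have : (0 : ℝ) ≤ n := n.cast_nonneg
  linarith

theorem ascPochhammer_eval_ne_zero {t : ℝ} (ht : ∀ n : ℕ, t ≠ -n) (n : ℕ) :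
    (ascPochhammer ℝ n).eval t ≠ 0 := by
  rw [Ne, ascPochhammer_eval_eq_zero_iff]
  rintro ⟨k, -, hk⟩
  exact ht k (by linarith)

/-- The coefficient of `xⁿ` in the series `₃F₂(A, B, C; D, E; x)`. -/
noncomputable def genHyp32Coeff (A B C D E : ℝ) (n : ℕ) : ℝ :=
  ((ascPochhammer ℝ n).eval A * (ascPochhammer ℝ n).eval B * (ascPochhammer ℝ n).eval C) /
    ((n.factorial : ℝ) * (ascPochhammer ℝ n).eval D * (ascPochhammer ℝ n).eval E)

variable {A B C D E p q c x : ℝ}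

theorem genHyp32_one : genHyp32 A B C D E 1 = ∑' n, genHyp32Coeff A B C D E n := by
  simp only [genHyp32, genHyp32Coeff, one_pow, mul_one]

theorem genHyp32Coeff_succ (n : ℕ) :
    genHyp32Coeff A B C D E (n + 1) =
      genHyp32Coeff A B C D E n *
        ((A + n) * (B + n) * (C + n) / ((n + 1) * (D + n) * (E + n))) := by
  simp only [genHyp32Coeff, ascPochhammer_succ_eval, Nat.factorial_succ, Nat.cast_mul,
    Nat.cast_succ, div_eq_mul_inv, mul_inv]
  ring

theorem tendsto_genHyp32Coeff_ratio (A B C D E : ℝ) :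
    Tendsto (fun n : ℕ => ((n : ℝ) + 1) *
      ((A + n) * (B + n) * (C + n) / ((n + 1) * (D + n) * (E + n))) - n) atTop
      (𝓝 (A + B + C - D - E)) := by
  have hcont : ContinuousAt (fun t : ℝ => (A + B + C - D - E +
      (A * B + A * C + B * C - D * E) * t + A * B * C * t ^ 2) / ((D * t + 1) * (E * t + 1))) 0 :=
    ContinuousAt.div (by fun_prop) (by fun_prop) (by simp)
  have hlim := hcont.tendsto.comp (tendsto_one_div_atTop_nhds_zero_nat (𝕜 := ℝ))
  simp only [mul_zero, add_zero, zero_add, mul_one, div_one, ne_eq, OfNat.ofNat_ne_zero,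
    not_false_eq_true, zero_pow] at hlim
  refine hlim.congr' ?_
  have hcast := tendsto_natCast_atTop_atTop (R := ℝ)
  filter_upwards [hcast.eventually_gt_atTop 0, hcast.eventually_gt_atTop (-D),
    hcast.eventually_gt_atTop (-E)] with n hn hD hE
  have hD' : D + n ≠ 0 := by linarith
  have hE' : E + n ≠ 0 := by linarith
  simp only [Function.comp]
  field_simp
  ring

theorem summable_abs_genHyp32Coeff (h : A + B + C < D + E) :
    Summable fun n => |genHyp32Coeff A B C D E n| :=
  summable_abs_of_tendsto_ratio genHyp32Coeff_succ (by linarith)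
    (tendsto_genHyp32Coeff_ratio A B C D E)

theorem tendsto_nat_mul_genHyp32Coeff (h : A + B + C < D + E) :
    Tendsto (fun n : ℕ => n * genHyp32Coeff A B C D E n) atTop (𝓝 0) :=
  tendsto_nat_mul_of_tendsto_ratio genHyp32Coeff_succ (by linarith)
    (tendsto_genHyp32Coeff_ratio A B C D E)

theorem genHyp32Coeff_cancel (hA : ∀ n : ℕ, A ≠ -n) :
    genHyp32Coeff A B C A E = ordinaryHypergeometricCoefficient B C E := by
  ext n
  have := ascPochhammer_eval_ne_zero hA n
  rw [genHyp32Coeff, ordinaryHypergeometricCoefficient]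
  field_simp

theorem ordinaryHypergeometric_one_eq_tsum :
    ordinaryHypergeometric p q c (1 : ℝ) = ∑' n, ordinaryHypergeometricCoefficient p q c n := by
  simp only [ordinaryHypergeometric_eq_tsum, one_pow, smul_eq_mul, mul_one]

theorem genHyp32_cancel_one (hA : ∀ n : ℕ, A ≠ -n) :
    genHyp32 A p q A c 1 = ordinaryHypergeometric p q c 1 := by
  rw [genHyp32_one, genHyp32Coeff_cancel hA, ordinaryHypergeometric_one_eq_tsum]

theorem summable_ordinaryHypergeometricCoefficient (h : 0 < c - p - q) :
    Summable (ordinaryHypergeometricCoefficient p q c) := by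
  rw [← genHyp32Coeff_cancel (ne_neg_natCast_of_pos one_pos)]
  exact (summable_abs_genHyp32Coeff (by linarith)).of_abs

theorem tendsto_nat_mul_ordinaryHypergeometricCoefficient (h : 0 < c - p - q) :
    Tendsto (fun n : ℕ => n * ordinaryHypergeometricCoefficient p q c n) atTop (𝓝 0) := by
  rw [← genHyp32Coeff_cancel (ne_neg_natCast_of_pos one_pos)]
  exact tendsto_nat_mul_genHyp32Coeff (by linarith)

theorem ordinaryHypergeometricCoefficient_succ (n : ℕ) :
    ordinaryHypergeometricCoefficient p q c (n + 1) =
      ordinaryHypergeometricCoefficient p q c n * ((p + n) * (q + n) / ((n + 1) * (c + n))) := by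
  simp only [ordinaryHypergeometricCoefficient, ascPochhammer_succ_eval, Nat.factorial_succ,
    Nat.cast_mul, Nat.cast_succ, div_eq_mul_inv, mul_inv]
  ring

theorem ordinaryHypergeometricCoefficient_add_one_right (hc : ∀ n : ℕ, c ≠ -n) (n : ℕ) :
    ordinaryHypergeometricCoefficient p q (c + 1) n =
      ordinaryHypergeometricCoefficient p q c n * (c / (c + n)) := by
  have hshift : (ascPochhammer ℝ n).eval c * (c + n) = c * (ascPochhammer ℝ n).eval (c + 1) := by
    rw [← ascPochhammer_succ_eval, ascPochhammer_succ_left]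
    simp only [Polynomial.eval_mul, Polynomial.eval_X, Polynomial.eval_comp, Polynomial.eval_add,
      Polynomial.eval_one]
  have hcn : c + n ≠ 0 := fun h0 => hc n (by linarith)
  have hcn' := ascPochhammer_eval_ne_zero hc n
  have hcn'' : (ascPochhammer ℝ n).eval (c + 1) ≠ 0 :=
    right_ne_zero_of_mul (hshift ▸ mul_ne_zero hcn' hcn)
  simp only [ordinaryHypergeometricCoefficient]
  field_simp
  linear_combination (ascPochhammer ℝ n).eval p * (ascPochhammer ℝ n).eval q * hshift

theorem ordinaryHypergeometric_one_contiguous (hc : ∀ n : ℕ, c ≠ -n) (h : 0 < c - p - q) :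
    (c - p) * (c - q) * ordinaryHypergeometric p q (c + 1) (1 : ℝ) =
      c * (c - p - q) * ordinaryHypergeometric p q c (1 : ℝ) := by
  have hs := (summable_ordinaryHypergeometricCoefficient h).mul_left (c * (c - p - q))
  have hs' := (summable_ordinaryHypergeometricCoefficient (p := p) (q := q) (c := c + 1)
    (by linarith)).mul_left ((c - p) * (c - q))
  have htel (n : ℕ) : ∑ k ∈ Finset.range n,
      ((c - p) * (c - q) * ordinaryHypergeometricCoefficient p q (c + 1) k -
        c * (c - p - q) * ordinaryHypergeometricCoefficient p q c k) =
      c * (n * ordinaryHypergeometricCoefficient p q c n) := by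
    induction n with
    | zero => simp
    | succ n ih =>
      have hcn : c + n ≠ 0 := fun h0 => hc n (by linarith)
      rw [Finset.sum_range_succ, ih, ordinaryHypergeometricCoefficient_succ,
        ordinaryHypergeometricCoefficient_add_one_right hc]
      push_cast
      field_simp
      ring
  have hlim := (hs'.sub hs).hasSum.tendsto_sum_nat
  simp only [htel] at hlim
  have hzero := tendsto_nhds_unique hlim
    ((tendsto_nat_mul_ordinaryHypergeometricCoefficient h).const_mul c)
  rw [hs'.tsum_sub hs, tsum_mul_left, tsum_mul_left, mul_zero, sub_eq_zero] at hzero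
  rwa [ordinaryHypergeometric_one_eq_tsum, ordinaryHypergeometric_one_eq_tsum]

theorem ordinaryHypergeometric_one_add_natCast (hc : ∀ n : ℕ, c ≠ -n) (hp : ∀ n : ℕ, c - p ≠ -n)
    (hq : ∀ n : ℕ, c - q ≠ -n) (h : 0 < c - p - q) (k : ℕ) :
    ordinaryHypergeometric p q (c + k) (1 : ℝ) =
      (ascPochhammer ℝ k).eval c * (ascPochhammer ℝ k).eval (c - p - q) /
        ((ascPochhammer ℝ k).eval (c - p) * (ascPochhammer ℝ k).eval (c - q)) *
      ordinaryHypergeometric p q c (1 : ℝ) := by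
  induction k with
  | zero => simp
  | succ k ih =>
    have : (0 : ℝ) ≤ k := k.cast_nonneg
    have hpk : c - p + k ≠ 0 := fun h0 => hp k (by linarith)
    have hqk : c - q + k ≠ 0 := fun h0 => hq k (by linarith)
    have hpk' := ascPochhammer_eval_ne_zero hp k
    have hqk' := ascPochhammer_eval_ne_zero hq k
    have hstep := ordinaryHypergeometric_one_contiguous (p := p) (q := q) (c := c + k)
      (fun n h0 => hc (k + n) (by push_cast; linarith)) (by linarith)
    rw [ih, add_sub_right_comm c k p, add_sub_right_comm c k q, add_sub_right_comm (c - p) k q]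
      at hstep
    rw [← mul_right_inj' (mul_ne_zero hpk hqk), Nat.cast_succ, ← add_assoc, hstep]
    simp only [ascPochhammer_succ_eval]
    field_simp

theorem hasSum_ordinaryHypergeometric (hp : ∀ n : ℕ, p ≠ -n) (hq : ∀ n : ℕ, q ≠ -n)
    (hc : ∀ n : ℕ, c ≠ -n) (hx : |x| < 1) :
    HasSum (fun n => ordinaryHypergeometricCoefficient p q c n * x ^ n)
      (ordinaryHypergeometric p q c x) := by
  have hrad : (ordinaryHypergeometricSeries ℝ p q c).radius = 1 :=
    ordinaryHypergeometricSeries_radius_eq_one ℝ p q c fun k =>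
      ⟨fun h => hp k (by linarith), fun h => hq k (by linarith), fun h => hc k (by linarith)⟩
  have hmem : x ∈ Metric.eball (0 : ℝ) (ordinaryHypergeometricSeries ℝ p q c).radius := by
    rw [hrad, ← ENNReal.ofReal_one, Metric.eball_ofReal]
    simpa using hx
  have hsum := (ordinaryHypergeometricSeries ℝ p q c).hasSum hmem
  simp only [ordinaryHypergeometricSeries_apply_eq, smul_eq_mul] at hsum
  exact hsum

theorem ordinaryHypergeometricCoefficient_pos (hp : 0 < p) (hq : 0 < q) (hc : 0 < c) (n : ℕ) :
    0 < ordinaryHypergeometricCoefficient p q c n := by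
  have := ascPochhammer_pos n _ hp
  have := ascPochhammer_pos n _ hq
  have := ascPochhammer_pos n _ hc
  positivity

theorem ordinaryHypergeometric_pos (hp : 0 < p) (hq : 0 < q) (hc : 0 < c) (hx₀ : 0 ≤ x)
    (hx₁ : x < 1) : 0 < ordinaryHypergeometric p q c x := by
  have hsum := hasSum_ordinaryHypergeometric (ne_neg_natCast_of_pos hp) (ne_neg_natCast_of_pos hq)
    (ne_neg_natCast_of_pos hc) (abs_lt.2 ⟨by linarith, hx₁⟩)
  have hcoeff := ordinaryHypergeometricCoefficient_pos hp hq hc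
  rw [← hsum.tsum_eq]
  exact hsum.summable.tsum_pos (fun n => mul_nonneg (hcoeff n).le (pow_nonneg hx₀ n)) 0
    (by simpa only [pow_zero, mul_one] using hcoeff 0)

theorem hasSum_one_sub_rpow_neg (s : ℝ) {z : ℝ} (hz : |z| < 1) :
    HasSum (fun n : ℕ => (ascPochhammer ℝ n).eval s / n.factorial * z ^ n) (1 / (1 - z) ^ s) := by
  have hsum := (Real.one_div_one_sub_rpow_hasFPowerSeriesOnBall_zero s).hasSum (y := z) (by
    rw [← ENNReal.ofReal_one, Metric.eball_ofReal]
    simpa using hz)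
  simp only [zero_add, FormalMultilinearSeries.ofScalars_apply_eq, smul_eq_mul] at hsum
  have hcoeff (n : ℕ) :
      (ascPochhammer ℝ n).eval s / n.factorial = Ring.choose (s + n - 1) n := by
    rw [div_eq_iff (by positivity), ← Polynomial.ascPochhammer_smeval_eq_eval,
      ← Ring.factorial_nsmul_multichoose_eq_ascPochhammer, ← Ring.multichoose_eq,
      nsmul_eq_mul, mul_comm]
  simpa only [hcoeff] using hsum

end HypergeometricCoefficients

section Beta

variable {a b : ℝ}

theorem beta_comm (a b : ℝ) : beta a b = beta b a := by
  rw [beta, beta, mul_comm, add_comm]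

theorem beta_add_one_left (ha : 0 < a) (hb : 0 < b) :
    beta (a + 1) b = beta a b * (a / (a + b)) := by
  have := (Real.Gamma_pos_of_pos (add_pos ha hb)).ne'
  rw [beta, beta, Real.Gamma_add_one ha.ne', add_right_comm, Real.Gamma_add_one (by positivity)]
  field_simp

theorem beta_add_natCast_left (ha : 0 < a) (hb : 0 < b) (n : ℕ) :
    beta (a + n) b =
      beta a b * ((ascPochhammer ℝ n).eval a / (ascPochhammer ℝ n).eval (a + b)) := by
  induction n with
  | zero => simp
  | succ n ih =>
    have := (ascPochhammer_pos n _ (add_pos ha hb)).ne'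
    rw [Nat.cast_succ, ← add_assoc, beta_add_one_left (by positivity) hb, ih,
      ascPochhammer_succ_eval, ascPochhammer_succ_eval, add_right_comm a _ b]
    field_simp

theorem beta_add_natCast_right (ha : 0 < a) (hb : 0 < b) (n : ℕ) :
    beta a (b + n) =
      beta a b * ((ascPochhammer ℝ n).eval b / (ascPochhammer ℝ n).eval (a + b)) := by
  rw [beta_comm, beta_add_natCast_left hb ha, beta_comm, add_comm b]

theorem integral_rpow_mul_one_sub_rpow (ha : 0 < a) (hb : 0 < b) :
    ∫ x in Ioo (0 : ℝ) 1, x ^ (a - 1) * (1 - x) ^ (b - 1) = beta a b := by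
  have hpdf : ∫ x in Ioo (0 : ℝ) 1, 1 / beta a b * x ^ (a - 1) * (1 - x) ^ (b - 1) = 1 := by
    have hnonneg : 0 ≤ᵐ[volume.restrict (Ioo (0 : ℝ) 1)]
        fun x => 1 / beta a b * x ^ (a - 1) * (1 - x) ^ (b - 1) := by
      filter_upwards [ae_restrict_mem measurableSet_Ioo] with x hx
      have hx0 := hx.1
      have hx1 := sub_pos.2 hx.2
      have hB := beta_pos ha hb
      simp only [Pi.zero_apply]
      positivity
    rw [integral_eq_lintegral_of_nonneg_ae hnonneg (by fun_prop), ← lintegral_betaPDF,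
      lintegral_betaPDF_eq_one ha hb, ENNReal.toReal_one]
  simp only [mul_assoc] at hpdf
  rwa [integral_const_mul, one_div, inv_mul_eq_one₀ (beta_pos ha hb).ne', eq_comm] at hpdf

theorem integrableOn_rpow_mul_one_sub_rpow (ha : 0 < a) (hb : 0 < b) :
    IntegrableOn (fun x : ℝ => x ^ (a - 1) * (1 - x) ^ (b - 1)) (Ioo 0 1) :=
  .of_integral_ne_zero <| by
    rw [integral_rpow_mul_one_sub_rpow ha hb]
    exact (beta_pos ha hb).ne'

end Beta

theorem integrable_tsum_of_summable_integral_norm {α ι E : Type*} [MeasurableSpace α]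
    {μ : Measure α} [Countable ι] [NormedAddCommGroup E] [CompleteSpace E] {F : ι → α → E}
    (hF : ∀ i, Integrable (F i) μ) (hs : Summable fun i => ∫ a, ‖F i a‖ ∂μ) :
    Integrable (fun a => ∑' i, F i a) μ := by
  have hfin : ∫⁻ a, ∑' i, ‖F i a‖ₑ ∂μ < ∞ := by
    simp only [lintegral_tsum fun i => (hF i).1.enorm,
      ← ofReal_integral_norm_eq_lintegral_enorm (hF _)]
    rw [← ENNReal.ofReal_tsum_of_nonneg (fun i => integral_nonneg fun a => norm_nonneg _) hs]
    exact ENNReal.ofReal_lt_top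
  have hsummable : ∀ᵐ a ∂μ, Summable fun i => F i a := by
    filter_upwards [ae_lt_top' (AEMeasurable.tsum fun i => (hF i).1.enorm) hfin.ne] with a ha
    have hnn : Summable fun i => ‖F i a‖₊ := ENNReal.tsum_coe_ne_top_iff_summable.1 ha.ne
    exact (NNReal.summable_coe.2 hnn).of_norm
  refine ⟨aestronglyMeasurable_of_tendsto_ae atTop (f := fun s a => ∑ i ∈ s, F i a)
    (fun s => Finset.aestronglyMeasurable_fun_sum _ fun i _ => (hF i).1) ?_,
    (lintegral_mono fun a => enorm_tsum_le_tsum_enorm).trans_lt hfin⟩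
  filter_upwards [hsummable] with a ha using ha.hasSum

section UnnormalizedDensity

/-- The unnormalized density on `(0, 1)` of the beta-hypergeometric distribution with parameters
`(a, b, p, q, r)`. -/
noncomputable def bhWeight (a b p q r x : ℝ) : ℝ :=
  x ^ (a - 1) * (1 - x) ^ (b - 1) * ordinaryHypergeometric p q r x

/-- The total mass of the unnormalized beta-hypergeometric distribution. -/
noncomputable def bhMass (a b p q r : ℝ) : ℝ :=
  ∫ x in Ioo (0 : ℝ) 1, bhWeight a b p q r x

variable {a b p q r s x y : ℝ}

theorem bhWeight_pos (hF : 0 < ordinaryHypergeometric p q r x) (hx : x ∈ Ioo (0 : ℝ) 1) :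
    0 < bhWeight a b p q r x := by
  have hx0 := hx.1
  have hx1 := sub_pos.2 hx.2
  unfold bhWeight
  positivity

/-- The `n`-th term of the expansion of `bhWeight a b p q r` that comes from the power series of
`₂F₁(p, q; r; ·)`. -/
noncomputable def bhWeightTerm (a b p q r : ℝ) (n : ℕ) (x : ℝ) : ℝ :=
  ordinaryHypergeometricCoefficient p q r n * (x ^ (a + n - 1) * (1 - x) ^ (b - 1))

theorem tsum_bhWeightTerm (hx : 0 < x) :
    ∑' n, bhWeightTerm a b p q r n x = bhWeight a b p q r x := by
  simp only [bhWeight, ordinaryHypergeometric_eq_tsum, ← tsum_mul_left]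
  refine tsum_congr fun n => ?_
  rw [bhWeightTerm, add_sub_right_comm, Real.rpow_add_natCast hx.ne', smul_eq_mul]
  ring

theorem integrableOn_bhWeightTerm (ha : 0 < a) (hb : 0 < b) (n : ℕ) :
    IntegrableOn (bhWeightTerm a b p q r n) (Ioo 0 1) :=
  (integrableOn_rpow_mul_one_sub_rpow (by positivity) hb).const_mul _

theorem integral_bhWeightTerm (ha : 0 < a) (hb : 0 < b) (n : ℕ) :
    ∫ x in Ioo (0 : ℝ) 1, bhWeightTerm a b p q r n x =
      beta a b * genHyp32Coeff a p q r (a + b) n := by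
  simp only [bhWeightTerm]
  rw [integral_const_mul, integral_rpow_mul_one_sub_rpow (by positivity) hb,
    beta_add_natCast_left ha hb, genHyp32Coeff, ordinaryHypergeometricCoefficient]
  simp only [mul_inv, div_eq_mul_inv]
  ring

theorem integral_norm_bhWeightTerm (ha : 0 < a) (hb : 0 < b) (n : ℕ) :
    ∫ x in Ioo (0 : ℝ) 1, ‖bhWeightTerm a b p q r n x‖ =
      beta a b * |genHyp32Coeff a p q r (a + b) n| := by
  have hnorm : ∀ x ∈ Ioo (0 : ℝ) 1, ‖bhWeightTerm a b p q r n x‖ =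
      |ordinaryHypergeometricCoefficient p q r n| * (x ^ (a + n - 1) * (1 - x) ^ (b - 1)) := by
    intro x hx
    have hx0 := hx.1
    have hx1 := sub_pos.2 hx.2
    rw [bhWeightTerm, norm_mul, Real.norm_eq_abs, Real.norm_of_nonneg (by positivity)]
  rw [setIntegral_congr_fun measurableSet_Ioo hnorm, integral_const_mul,
    ← abs_of_pos (beta_pos ha hb), ← abs_mul, ← integral_bhWeightTerm ha hb]
  simp only [bhWeightTerm]
  rw [integral_const_mul, integral_rpow_mul_one_sub_rpow (by positivity) hb,
    abs_mul _ (beta _ _), abs_of_pos (beta_pos (by positivity) hb)]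

theorem summable_integral_norm_bhWeightTerm (ha : 0 < a) (hb : 0 < b) (h : 0 < r + b - p - q) :
    Summable fun n => ∫ x in Ioo (0 : ℝ) 1, ‖bhWeightTerm a b p q r n x‖ := by
  simp only [integral_norm_bhWeightTerm ha hb]
  exact (summable_abs_genHyp32Coeff (by linarith)).mul_left _

theorem integrableOn_bhWeight (ha : 0 < a) (hb : 0 < b) (h : 0 < r + b - p - q) :
    IntegrableOn (bhWeight a b p q r) (Ioo 0 1) :=
  IntegrableOn.congr_fun
    (integrable_tsum_of_summable_integral_norm (integrableOn_bhWeightTerm ha hb)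
      (summable_integral_norm_bhWeightTerm ha hb h))
    (fun _ hx => tsum_bhWeightTerm hx.1) measurableSet_Ioo

theorem bhMass_eq_beta_mul_genHyp32 (ha : 0 < a) (hb : 0 < b) (h : 0 < r + b - p - q) :
    bhMass a b p q r = beta a b * genHyp32 a p q r (a + b) 1 := by
  rw [bhMass, ← setIntegral_congr_fun measurableSet_Ioo fun x hx => tsum_bhWeightTerm hx.1,
    ← integral_tsum_of_summable_integral_norm (integrableOn_bhWeightTerm ha hb)
      (summable_integral_norm_bhWeightTerm ha hb h), genHyp32_one, ← tsum_mul_left]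
  exact tsum_congr (integral_bhWeightTerm ha hb)

theorem bhMass_pos (ha : 0 < a) (hb : 0 < b) (h : 0 < r + b - p - q)
    (hF : ∀ x ∈ Ioo (0 : ℝ) 1, 0 < ordinaryHypergeometric p q r x) : 0 < bhMass a b p q r := by
  have hsupp : Function.support (bhWeight a b p q r) ∩ Ioo 0 1 = Ioo 0 1 :=
    inter_eq_right.2 fun x hx => (bhWeight_pos (hF x hx) hx).ne'
  rw [bhMass, setIntegral_pos_iff_support_of_nonneg_ae _ (integrableOn_bhWeight ha hb h), hsupp]
  · simp
  · filter_upwards [ae_restrict_mem measurableSet_Ioo] with x hx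
    exact (bhWeight_pos (hF x hx) hx).le

theorem bhMass_eq_beta_mul_ordinaryHypergeometric (hr : 0 < r) (hb : 0 < b)
    (h : 0 < r + b - p - q) :
    bhMass r b p q r = beta r b * ordinaryHypergeometric p q (r + b) (1 : ℝ) := by
  rw [bhMass_eq_beta_mul_genHyp32 hr hb h, genHyp32_cancel_one (ne_neg_natCast_of_pos hr)]

theorem ordinaryHypergeometric_one_pos (hr : 0 < r) (hb : 0 < b) (h : 0 < r + b - p - q)
    (hF : ∀ x ∈ Ioo (0 : ℝ) 1, 0 < ordinaryHypergeometric p q r x) :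
    0 < ordinaryHypergeometric p q (r + b) (1 : ℝ) := by
  have hmass := bhMass_pos hr hb h hF
  rw [bhMass_eq_beta_mul_ordinaryHypergeometric hr hb h] at hmass
  exact pos_of_mul_pos_right hmass (beta_pos hr hb).le

/-- In the contiguous relation both values of `₂F₁` are positive, which forces the sign of the
remaining factor. -/
theorem add_sub_pos_of_ordinaryHypergeometric_pos (hr : 0 < r) (hb : 0 < b)
    (hp : 0 < r + b - p) (h : 0 < r + b - p - q)
    (hF : ∀ x ∈ Ioo (0 : ℝ) 1, 0 < ordinaryHypergeometric p q r x) : 0 < r + b - q := by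
  have hpos := ordinaryHypergeometric_one_pos hr hb h hF
  have hpos' := ordinaryHypergeometric_one_pos hr (add_pos hb one_pos) (by linarith) hF
  have hcont := ordinaryHypergeometric_one_contiguous
    (ne_neg_natCast_of_pos (add_pos hr hb)) h
  rw [← add_assoc] at hpos'
  have hprod : 0 < (r + b - p) * (r + b - q) *
      ordinaryHypergeometric p q (r + b + 1) (1 : ℝ) := by
    rw [hcont]
    positivity
  exact pos_of_mul_pos_right (pos_of_mul_pos_left hprod hpos'.le) hp.le

theorem bhMass_add_natCast (hr : 0 < r) (hb : 0 < b) (hp : 0 < r + b - p) (hq : 0 < r + b - q)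
    (h : 0 < r + b - p - q) (n : ℕ) :
    bhMass r (b + n) p q r =
      (ascPochhammer ℝ n).eval b * (ascPochhammer ℝ n).eval (r + b - p - q) /
        ((ascPochhammer ℝ n).eval (r + b - p) * (ascPochhammer ℝ n).eval (r + b - q)) *
      bhMass r b p q r := by
  have : (0 : ℝ) ≤ n := n.cast_nonneg
  have hrb := add_pos hr hb
  have := (ascPochhammer_pos n _ hrb).ne'
  rw [bhMass_eq_beta_mul_ordinaryHypergeometric hr (by positivity) (by linarith),
    bhMass_eq_beta_mul_ordinaryHypergeometric hr hb h, beta_add_natCast_right hr hb, ← add_assoc,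
    ordinaryHypergeometric_one_add_natCast (ne_neg_natCast_of_pos hrb) (ne_neg_natCast_of_pos hp)
      (ne_neg_natCast_of_pos hq) h]
  field_simp

theorem hasSum_bhWeight_div_rpow (hx : x < 1) (hxy : |y * (1 - x)| < 1) :
    HasSum (fun n : ℕ => (ascPochhammer ℝ n).eval s / n.factorial * y ^ n *
        bhWeight a (b + n) p q r x)
      (bhWeight a b p q r x / (1 - y * (1 - x)) ^ s) := by
  rw [← mul_one_div]
  refine ((hasSum_one_sub_rpow_neg s hxy).mul_left (bhWeight a b p q r x)).congr_fun fun n => ?_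
  simp only [bhWeight]
  rw [add_sub_right_comm, Real.rpow_add_natCast (sub_pos.2 hx).ne', mul_pow]
  ring

theorem lintegral_bhWeight_div_rpow (ha : 0 < a) (hb : 0 < b) (h : 0 < r + b - p - q)
    (hF : ∀ x ∈ Ioo (0 : ℝ) 1, 0 < ordinaryHypergeometric p q r x) (hs : 0 < s)
    (hy : y ∈ Ioo (0 : ℝ) 1) :
    ∫⁻ x in Ioo (0 : ℝ) 1, ENNReal.ofReal (bhWeight a b p q r x / (1 - y * (1 - x)) ^ s) =
      ∑' n : ℕ, ENNReal.ofReal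
        ((ascPochhammer ℝ n).eval s / n.factorial * y ^ n * bhMass a (b + n) p q r) := by
  have hcoeff (n : ℕ) : 0 ≤ (ascPochhammer ℝ n).eval s / n.factorial * y ^ n := by
    have := ascPochhammer_pos n _ hs
    have := hy.1
    positivity
  have hnonneg (n : ℕ) : ∀ x ∈ Ioo (0 : ℝ) 1, 0 ≤
      (ascPochhammer ℝ n).eval s / n.factorial * y ^ n * bhWeight a (b + n) p q r x :=
    fun x hx => mul_nonneg (hcoeff n) (bhWeight_pos (hF x hx) hx).le
  have hint (n : ℕ) : IntegrableOn (fun x => (ascPochhammer ℝ n).eval s / n.factorial * y ^ n *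
      bhWeight a (b + n) p q r x) (Ioo 0 1) := by
    have : (0 : ℝ) ≤ n := n.cast_nonneg
    exact (integrableOn_bhWeight ha (by positivity) (by linarith)).const_mul _
  have hexpand : ∀ x ∈ Ioo (0 : ℝ) 1,
      ENNReal.ofReal (bhWeight a b p q r x / (1 - y * (1 - x)) ^ s) =
        ∑' n : ℕ, ENNReal.ofReal ((ascPochhammer ℝ n).eval s / n.factorial * y ^ n *
          bhWeight a (b + n) p q r x) := by
    intro x hx
    have hx1 := sub_pos.2 hx.2
    have hxy : |y * (1 - x)| < 1 := by
      rw [abs_of_pos (mul_pos hy.1 hx1)]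
      nlinarith [hx.1, hy.2]
    have hsum := hasSum_bhWeight_div_rpow (a := a) (b := b) (p := p) (q := q) (r := r) (s := s)
      hx.2 hxy
    rw [← hsum.tsum_eq, ENNReal.ofReal_tsum_of_nonneg (fun n => hnonneg n x hx) hsum.summable]
  rw [setLIntegral_congr_fun measurableSet_Ioo hexpand,
    lintegral_tsum fun n => (hint n).aemeasurable.ennreal_ofReal]
  refine tsum_congr fun n => ?_
  rw [← ofReal_integral_eq_lintegral_ofReal (hint n)
    ((ae_restrict_mem measurableSet_Ioo).mono (hnonneg n)), integral_const_mul, bhMass]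

theorem lintegral_bhWeight_div_rpow_eq_ordinaryHypergeometric (hr : 0 < r) (hb : 0 < b)
    (hp : 0 < r + b - p) (h : 0 < r + b - p - q)
    (hF : ∀ x ∈ Ioo (0 : ℝ) 1, 0 < ordinaryHypergeometric p q r x) (hy : y ∈ Ioo (0 : ℝ) 1) :
    ∫⁻ x in Ioo (0 : ℝ) 1,
        ENNReal.ofReal (bhWeight r b p q r x / (1 - y * (1 - x)) ^ (r + b - p)) =
      ENNReal.ofReal
        (bhMass r b p q r * ordinaryHypergeometric (r + b - p - q) b (r + b - q) y) := by
  have hq := add_sub_pos_of_ordinaryHypergeometric_pos hr hb hp h hF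
  have hsum := (hasSum_ordinaryHypergeometric (ne_neg_natCast_of_pos h) (ne_neg_natCast_of_pos hb)
    (ne_neg_natCast_of_pos hq) (abs_lt.2 ⟨by linarith [hy.1], hy.2⟩)).mul_left (bhMass r b p q r)
  rw [lintegral_bhWeight_div_rpow hr hb h hF hp hy, ← hsum.tsum_eq,
    ENNReal.ofReal_tsum_of_nonneg (fun n => ?_) hsum.summable]
  · refine tsum_congr fun n => ?_
    have := (ascPochhammer_pos n _ hp).ne'
    have := (ascPochhammer_pos n _ hq).ne'
    rw [bhMass_add_natCast hr hb hp hq h, ordinaryHypergeometricCoefficient]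
    congr 1
    field_simp
  · exact mul_nonneg (bhMass_pos hr hb h hF).le
      (mul_nonneg (ordinaryHypergeometricCoefficient_pos h hb hq n).le (pow_nonneg hy.1.le n))

end UnnormalizedDensity

section SecondBeta

/-- The density on `(0, 1)` of `1 / (1 + x * W)`, for a fixed `x > 0` and `W` distributed according
to `betaSecondKind u`. -/
noncomputable def invOneAddMulPDF (u : Fin 2 → ℝ) (x y : ℝ) : ℝ :=
  1 / beta (u 0) (u 1) *
    (x ^ u 1 * y ^ (u 1 - 1) * (1 - y) ^ (u 0 - 1) / (1 - y * (1 - x)) ^ (u 0 + u 1))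

variable {u : Fin 2 → ℝ} {x y : ℝ}

theorem one_div_one_add_mul_div (hx : x ≠ 0) (hy : y ≠ 0) :
    1 / (1 + x * ((1 - y) / (x * y))) = y := by
  field_simp
  ring

theorem bijOn_one_sub_div_mul (hx : 0 < x) :
    BijOn (fun y => (1 - y) / (x * y)) (Ioo 0 1) (Ioi 0) := by
  refine InvOn.bijOn (f' := fun w => 1 / (1 + x * w)) ⟨fun y hy => ?_, fun w (hw : 0 < w) => ?_⟩
    (fun y hy => ?_) (fun w (hw : 0 < w) => ?_)
  · exact one_div_one_add_mul_div hx.ne' hy.1.ne'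
  · field_simp
    ring
  · exact div_pos (sub_pos.2 hy.2) (mul_pos hx hy.1)
  · have hxw := mul_pos hx hw
    exact ⟨by positivity, (div_lt_one (by positivity)).2 (by linarith)⟩

theorem lintegral_Ioi_eq_lintegral_Ioo_one_sub_div_mul (hx : 0 < x) (g : ℝ → ℝ≥0∞) :
    ∫⁻ w in Ioi 0, g w =
      ∫⁻ y in Ioo (0 : ℝ) 1, ENNReal.ofReal (1 / (x * y ^ 2)) * g ((1 - y) / (x * y)) := by
  have hderiv : ∀ y ∈ Ioo (0 : ℝ) 1, HasDerivWithinAt (fun y : ℝ => (1 - y) / (x * y))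
      (-(1 / (x * y ^ 2))) (Ioo 0 1) y := by
    intro y hy
    have hy0 := hy.1
    have h := ((hasDerivAt_id' y).const_sub 1).div ((hasDerivAt_id' y).const_mul x) (by positivity)
    refine (h.congr_deriv ?_).hasDerivWithinAt
    field_simp
    ring
  have hbij := bijOn_one_sub_div_mul hx
  rw [← hbij.image_eq,
    lintegral_image_eq_lintegral_abs_deriv_mul measurableSet_Ioo hderiv hbij.injOn]
  refine setLIntegral_congr_fun measurableSet_Ioo fun y hy => ?_
  have hy0 := hy.1
  simp only [abs_neg]
  rw [abs_of_pos (by positivity)]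

theorem invOneAddMulPDF_eq (hx : 0 < x) (hy : y ∈ Ioo (0 : ℝ) 1) :
    1 / (x * y ^ 2) * (1 / beta (u 0) (u 1) *
      (((1 - y) / (x * y)) ^ (u 0 - 1) / (1 + (1 - y) / (x * y)) ^ (u 0 + u 1))) =
    invOneAddMulPDF u x y := by
  have hy0 := hy.1
  have hy1 := sub_pos.2 hy.2
  have hxy := mul_pos hx hy0
  have hD : 0 < 1 - y * (1 - x) := by linarith
  have hone : 1 + (1 - y) / (x * y) = (1 - y * (1 - x)) / (x * y) := by
    field_simp
    ring
  have hpow {t : ℝ} (ht : 0 < t) :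
      t ^ (u 0 + u 1) = t ^ (u 0 - 1) * t ^ (u 1 - 1) * t ^ 2 := by
    rw [← Real.rpow_add ht, ← Real.rpow_add_natCast ht.ne']
    push_cast
    ring_nf
  have hx1 : x ^ u 1 = x ^ (u 1 - 1) * x := by
    rw [← Real.rpow_add_one hx.ne', sub_add_cancel]
  have := Real.rpow_pos_of_pos hxy (u 0 - 1)
  have := Real.rpow_pos_of_pos hD (u 0 + u 1)
  rw [invOneAddMulPDF, hone, Real.div_rpow hy1.le hxy.le, Real.div_rpow hD.le hxy.le, hpow hxy,
    Real.mul_rpow hx.le hy0.le (z := u 1 - 1), hx1]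
  field_simp

theorem map_betaSecondKind (u : Fin 2 → ℝ) (hx : 0 < x) :
    (betaSecondKind u).map (fun w => 1 / (1 + x * w)) =
      (volume.restrict (Ioo 0 1)).withDensity fun y => ENNReal.ofReal (invOneAddMulPDF u x y) := by
  refine Measure.ext_of_lintegral _ fun φ hφ => ?_
  rw [lintegral_map hφ (by fun_prop), betaSecondKind,
    lintegral_withDensity_eq_lintegral_mul _ (by fun_prop) (by fun_prop),
    lintegral_withDensity_eq_lintegral_mul _ (by unfold invOneAddMulPDF; fun_prop) hφ,
    lintegral_Ioi_eq_lintegral_Ioo_one_sub_div_mul hx]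
  refine setLIntegral_congr_fun measurableSet_Ioo fun y hy => ?_
  have hy0 := hy.1
  simp only [Pi.mul_apply]
  rw [one_div_one_add_mul_div hx.ne' hy0.ne', ← mul_assoc,
    ← ENNReal.ofReal_mul (by positivity), invOneAddMulPDF_eq hx hy]

theorem isProbabilityMeasure_betaSecondKind (h₀ : 0 < u 0) (h₁ : 0 < u 1) :
    IsProbabilityMeasure (betaSecondKind u) := by
  have hpdf (y : ℝ) : invOneAddMulPDF u 1 y =
      1 / beta (u 1) (u 0) * y ^ (u 1 - 1) * (1 - y) ^ (u 0 - 1) := by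
    simp only [invOneAddMulPDF, sub_self, mul_zero, sub_zero, Real.one_rpow, one_mul, div_one,
      beta_comm (u 0), mul_assoc]
  constructor
  rw [← preimage_univ (f := fun w : ℝ => 1 / (1 + 1 * w)),
    ← Measure.map_apply (by fun_prop) MeasurableSet.univ, map_betaSecondKind u one_pos,
    withDensity_apply _ MeasurableSet.univ, setLIntegral_univ]
  simp only [hpdf]
  rw [← lintegral_betaPDF, lintegral_betaPDF_eq_one h₁ h₀]

end SecondBeta

theorem map_prod_eq_withDensity {α β γ : Type*} [MeasurableSpace α] [MeasurableSpace β]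
    [MeasurableSpace γ] {μ : Measure α} {ρ : Measure β} {ν : Measure γ} [SFinite μ] [SFinite ρ]
    [SFinite ν] {g : α × β → γ} (hg : Measurable g) {k : α → γ → ℝ≥0∞}
    (hk : Measurable (Function.uncurry k))
    (h : ∀ᵐ x ∂μ, ρ.map (fun w => g (x, w)) = ν.withDensity (k x)) :
    (μ.prod ρ).map g = ν.withDensity fun y => ∫⁻ x, k x y ∂μ := by
  ext s hs
  rw [Measure.map_apply hg hs, Measure.prod_apply (hg hs), withDensity_apply _ hs,
    lintegral_lintegral_swap (by exact (hk.comp measurable_swap).aemeasurable)]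
  refine lintegral_congr_ae ?_
  filter_upwards [h] with x hx
  rw [← withDensity_apply _ hs, ← hx, Measure.map_apply (by fun_prop) hs]
  rfl

section BasicIdentity

variable {v : Fin 5 → ℝ}

theorem matM_mulVec (v : Fin 5 → ℝ) : matM *ᵥ v =
    ![v 4 - v 0, v 0 + v 1 - v 2, v 4 + v 1 - v 2 - v 3, v 1, v 4 + v 1 - v 3] := by
  ext i
  fin_cases i <;> simp [matM, mulVec, dotProduct, Fin.sum_univ_five] <;> ring

theorem matPi_mulVec (v : Fin 5 → ℝ) : matPi *ᵥ v = ![v 0 + v 1 - v 2, v 4 - v 0] := by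
  ext i
  fin_cases i <;> simp [matPi, mulVec, dotProduct, Fin.sum_univ_five] <;> ring

theorem bhDensity_eq (hv : v ∈ paramP) (x : ℝ) :
    bhDensity v x = bhWeight (v 0) (v 1) (v 2) (v 3) (v 4) x /
      bhMass (v 0) (v 1) (v 2) (v 3) (v 4) := by
  obtain ⟨-, ha, hb, h⟩ := hv
  rw [bhMass_eq_beta_mul_genHyp32 ha hb h, bhDensity, bhWeight]

theorem bhMass_pos_of_mem_paramP (hv : v ∈ paramP) :
    0 < bhMass (v 0) (v 1) (v 2) (v 3) (v 4) := by
  obtain ⟨⟨-, hF⟩, ha, hb, h⟩ := hv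
  exact bhMass_pos ha hb h hF

theorem bhDensity_pos (hv : v ∈ paramP) {x : ℝ} (hx : x ∈ Ioo (0 : ℝ) 1) : 0 < bhDensity v x := by
  rw [bhDensity_eq hv]
  exact div_pos (bhWeight_pos (hv.1.2 x hx) hx) (bhMass_pos_of_mem_paramP hv)

theorem integrableOn_bhDensity (hv : v ∈ paramP) : IntegrableOn (bhDensity v) (Ioo 0 1) := by
  rw [funext (bhDensity_eq hv)]
  exact (integrableOn_bhWeight hv.2.1 hv.2.2.1 hv.2.2.2).div_const _

theorem isProbabilityMeasure_BH (hv : v ∈ paramP) : IsProbabilityMeasure (BH v) := by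
  have hnonneg : 0 ≤ᵐ[volume.restrict (Ioo 0 1)] bhDensity v :=
    (ae_restrict_mem measurableSet_Ioo).mono fun x hx => (bhDensity_pos hv hx).le
  constructor
  rw [BH, withDensity_apply _ MeasurableSet.univ, setLIntegral_univ,
    ← ofReal_integral_eq_lintegral_ofReal (integrableOn_bhDensity hv) hnonneg,
    funext (bhDensity_eq hv), integral_div, ← bhMass,
    div_self (bhMass_pos_of_mem_paramP hv).ne', ENNReal.ofReal_one]

theorem matM_mulVec_mem_paramP (hv : v ∈ paramP) (h₁ : 0 < v 0 + v 1 - v 2)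
    (h₂ : 0 < v 4 - v 0) : matM *ᵥ v ∈ paramP := by
  obtain ⟨⟨-, hF⟩, ha, hb, h⟩ := hv
  have hq : 0 < v 4 + v 1 - v 3 :=
    add_sub_pos_of_ordinaryHypergeometric_pos (by linarith) hb (by linarith) h hF
  rw [matM_mulVec]
  refine ⟨⟨ne_neg_natCast_of_pos hq, fun x hx => ordinaryHypergeometric_pos h hb hq hx.1.le hx.2⟩,
    h₂, h₁, ?_⟩
  change 0 < v 4 + v 1 - v 3 + (v 0 + v 1 - v 2) - (v 4 + v 1 - v 2 - v 3) - v 1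
  linarith

theorem bhWeight_mul_invOneAddMulPDF {a b p q r x y : ℝ} (hx : 0 < x) :
    bhWeight a b p q r x * invOneAddMulPDF ![a + b - p, r - a] x y =
      1 / beta (a + b - p) (r - a) * (y ^ (r - a - 1) * (1 - y) ^ (a + b - p - 1)) *
        (bhWeight r b p q r x / (1 - y * (1 - x)) ^ (r + b - p)) := by
  have hxr : x ^ (r - 1) = x ^ (a - 1) * x ^ (r - a) := by
    rw [← Real.rpow_add hx]
    ring_nf
  have hexp : a + b - p + (r - a) = r + b - p := by ring
  simp only [invOneAddMulPDF, bhWeight, cons_val_zero, cons_val_one, hxr, hexp]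
  ring

theorem lintegral_invOneAddMulPDF_BH (hv : v ∈ paramP) (h₁ : 0 < v 0 + v 1 - v 2)
    (h₂ : 0 < v 4 - v 0) {y : ℝ} (hy : y ∈ Ioo (0 : ℝ) 1) :
    ∫⁻ x, ENNReal.ofReal (invOneAddMulPDF (matPi *ᵥ v) x y) ∂BH v =
      ENNReal.ofReal (bhMass (v 4) (v 1) (v 2) (v 3) (v 4) /
          (bhMass (v 0) (v 1) (v 2) (v 3) (v 4) * beta (v 0 + v 1 - v 2) (v 4 - v 0)) *
        bhWeight (v 4 - v 0) (v 0 + v 1 - v 2) (v 4 + v 1 - v 2 - v 3) (v 1)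
          (v 4 + v 1 - v 3) y) := by
  obtain ⟨⟨-, hF⟩, ha, hb, h⟩ := id hv
  have hm := bhMass_pos_of_mem_paramP hv
  have hB := beta_pos h₁ h₂
  have hy0 := hy.1
  have hy1 := sub_pos.2 hy.2
  have hintegrand : ∀ x ∈ Ioo (0 : ℝ) 1,
      ENNReal.ofReal (bhDensity v x) * ENNReal.ofReal (invOneAddMulPDF (matPi *ᵥ v) x y) =
        ENNReal.ofReal (1 / bhMass (v 0) (v 1) (v 2) (v 3) (v 4) *
            (1 / beta (v 0 + v 1 - v 2) (v 4 - v 0) *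
              (y ^ (v 4 - v 0 - 1) * (1 - y) ^ (v 0 + v 1 - v 2 - 1)))) *
          ENNReal.ofReal (bhWeight (v 4) (v 1) (v 2) (v 3) (v 4) x /
            (1 - y * (1 - x)) ^ (v 4 + v 1 - v 2)) := by
    intro x hx
    rw [← ENNReal.ofReal_mul (bhDensity_pos hv hx).le, ← ENNReal.ofReal_mul (by positivity),
      bhDensity_eq hv, matPi_mulVec, div_mul_eq_mul_div, bhWeight_mul_invOneAddMulPDF hx.1]
    congr 1
    field_simp
  rw [BH, lintegral_withDensity_eq_lintegral_mul₀
    (integrableOn_bhDensity hv).aemeasurable.ennreal_ofReal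
    (Measurable.aemeasurable (by unfold invOneAddMulPDF; fun_prop))]
  simp only [Pi.mul_apply]
  rw [setLIntegral_congr_fun measurableSet_Ioo hintegrand,
    lintegral_const_mul' _ _ ENNReal.ofReal_ne_top,
    lintegral_bhWeight_div_rpow_eq_ordinaryHypergeometric (by linarith) hb (by linarith) h hF hy,
    ← ENNReal.ofReal_mul (by positivity), bhWeight]
  congr 1
  field_simp

theorem isProbabilityMeasure_betaSecondKind_matPi_mulVec (h₁ : 0 < v 0 + v 1 - v 2)
    (h₂ : 0 < v 4 - v 0) : IsProbabilityMeasure (betaSecondKind (matPi *ᵥ v)) := by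
  rw [matPi_mulVec]
  exact isProbabilityMeasure_betaSecondKind h₁ h₂

theorem exists_map_prod_eq_smul_BH (hv : v ∈ paramP) (h₁ : 0 < v 0 + v 1 - v 2)
    (h₂ : 0 < v 4 - v 0) : ∃ K : ℝ≥0∞,
      ((BH v).prod (betaSecondKind (matPi *ᵥ v))).map (fun z => 1 / (1 + z.1 * z.2)) =
        K • BH (matM *ᵥ v) := by
  have := isProbabilityMeasure_BH hv
  have := isProbabilityMeasure_betaSecondKind_matPi_mulVec h₁ h₂
  have hMv := matM_mulVec_mem_paramP hv h₁ h₂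
  have hpos : ∀ᵐ x ∂BH v, 0 < x :=
    (withDensity_absolutelyContinuous _ _).ae_le
      ((ae_restrict_mem measurableSet_Ioo).mono fun _ hx => hx.1)
  rw [map_prod_eq_withDensity (by fun_prop)
    (k := fun x y => ENNReal.ofReal (invOneAddMulPDF (matPi *ᵥ v) x y))
    (by unfold invOneAddMulPDF Function.uncurry; fun_prop)
    (hpos.mono fun x hx => map_betaSecondKind _ hx), BH.eq_def (matM *ᵥ v)]
  refine ⟨ENNReal.ofReal (bhMass (v 4) (v 1) (v 2) (v 3) (v 4) /
      (bhMass (v 0) (v 1) (v 2) (v 3) (v 4) * beta (v 0 + v 1 - v 2) (v 4 - v 0)) *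
    bhMass (v 4 - v 0) (v 0 + v 1 - v 2) (v 4 + v 1 - v 2 - v 3) (v 1) (v 4 + v 1 - v 3)), ?_⟩
  rw [← withDensity_smul' _ _ ENNReal.ofReal_ne_top]
  refine withDensity_congr_ae ((ae_restrict_mem measurableSet_Ioo).mono fun y hy => ?_)
  have hm' := (bhMass_pos_of_mem_paramP hMv).ne'
  simp only [Pi.smul_apply, smul_eq_mul]
  rw [lintegral_invOneAddMulPDF_BH hv h₁ h₂ hy,
    ← ENNReal.ofReal_mul' (bhDensity_pos hMv hy).le, bhDensity_eq hMv]
  simp only [matM_mulVec, cons_val] at hm' ⊢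
  congr 1
  field_simp

theorem measurePreserving_one_div_one_add_mul (hv : v ∈ paramP) (h₁ : 0 < v 0 + v 1 - v 2)
    (h₂ : 0 < v 4 - v 0) :
    MeasurePreserving (fun z : ℝ × ℝ => 1 / (1 + z.1 * z.2))
      ((BH v).prod (betaSecondKind (matPi *ᵥ v))) (BH (matM *ᵥ v)) := by
  have hmeas : Measurable fun z : ℝ × ℝ => 1 / (1 + z.1 * z.2) := by fun_prop
  have := isProbabilityMeasure_BH hv
  have := isProbabilityMeasure_BH (matM_mulVec_mem_paramP hv h₁ h₂)
  have := isProbabilityMeasure_betaSecondKind_matPi_mulVec h₁ h₂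
  obtain ⟨K, hK⟩ := exists_map_prod_eq_smul_BH hv h₁ h₂
  have hmass := congrArg (fun m => m univ) hK
  have := Measure.isProbabilityMeasure_map (μ := (BH v).prod (betaSecondKind (matPi *ᵥ v)))
    hmeas.aemeasurable
  simp only [measure_univ, Measure.smul_apply, smul_eq_mul, mul_one] at hmass
  rw [← hmass, one_smul] at hK
  exact ⟨hmeas, hK⟩

end BasicIdentity

theorem theorem3p2 (v : Fin 5 → ℝ) (hv : v ∈ paramP)
    (h₁ : 0 < v 0 + v 1 - v 2) (h₂ : 0 < v 4 - v 0) :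
    matM *ᵥ v ∈ paramP ∧
      ∀ (Ω : Type*) [MeasurableSpace Ω] (μ : Measure Ω) [IsProbabilityMeasure μ] (X W : Ω → ℝ),
        HasLaw X (BH v) μ → HasLaw W (betaSecondKind (matPi *ᵥ v)) μ → IndepFun X W μ →
        HasLaw (fun ω => 1 / (1 + X ω * W ω)) (BH (matM *ᵥ v)) μ :=
  ⟨matM_mulVec_mem_paramP hv h₁ h₂, fun _ _ _ _ _ _ hX hW hXW =>
    (measurePreserving_one_div_one_add_mul hv h₁ h₂).fun_comp_hasLaw (hXW.hasLaw_prod hX hW)⟩
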